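/- **Theorem.** Let $P\subset\mathbb R^n$ be an $n$-dimensional unimodular smooth Fano polytope; that is, $P$ is an $n$-dimensional lattice polytope (with respect to $\mathbb Z^n$) containing the origin in its interior, all of whose vertices are primitive lattice points, such that every facet of $P$ has exactly $n$ vertices and these form a $\mathbb Z$-basis of $\mathbb Z^n$, and such that any $n$ vertices of $P$ either form a $\mathbb Z$-basis of $\mathbb Z^n$ or are linearly dependent. Let $P^*=\{x\in\mathbb R^n : \langle x,y\rangle\ge -1 \text{ for all } y\in P\}$ be its dual polytope. Then: (i) $P$ satisfies the strong Ewald condition: for every vertex $v$ of $P$ there is a linear map $\varphi:\mathbb R^n\to\mathbb R^n$, given by an integer matrix of determinant $\pm1$, such that $\varphi(P)\subset[-1,1]^n$ and $\varphi(v)=(1,\dots,1)$. (ii) $P^*$ satisfies the star Ewald condition: for every nonempty proper face $f$ of $P^*$ there is a point $\lambda\in P^*\cap(-P^*)\cap\mathbb Z^n$ with $\lambda\in\mathrm{Star}(f)\setminus\mathrm{star}(f)$ and $-\lambda\notin\mathrm{Star}(f)$, where $\mathrm{Star}(f)$ is the union of all facets (faces of codimension $1$) of $P^*$ containing $f$,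 and $\mathrm{star}(f)$ is the union of all ridges (faces of codimension $2$) of $P^*$ containing $f$. -/

import Mathlib

open scoped Pointwise

/-- The lattice `ℤⁿ` inside `ℝⁿ`: the integer span of the standard basis. -/
def stdLattice (n : ℕ) : Submodule ℤ (Fin n → ℝ) :=
  Submodule.span ℤ (Set.range (Pi.basisFun ℝ (Fin n)))

/-- The elements of `S` form a `ℤ`-basis of the lattice `ℤⁿ`. -/
def IsLatticeBasis {n : ℕ} (S : Set (Fin n → ℝ)) : Prop :=
  LinearIndepOn ℤ id S ∧ Submodule.span ℤ S = stdLattice n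

/-- A lattice point that is not a proper integer multiple of a lattice point
(so `0` is not primitive). -/
def IsPrimitivePoint {n : ℕ} (x : Fin n → ℝ) : Prop :=
  x ∈ stdLattice n ∧ ∀ (k : ℤ), ∀ y ∈ stdLattice n, x = k • y → k = 1 ∨ k = -1

/-- A lattice polytope: the convex hull of finitely many lattice points. -/
def IsLatticePolytope {n : ℕ} (P : Set (Fin n → ℝ)) : Prop :=
  ∃ S : Finset (Fin n → ℝ), (∀ x ∈ S, x ∈ stdLattice n) ∧
    P = convexHull ℝ (S : Set (Fin n → ℝ))

/-- The affine dimension of a nonempty set. -/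
noncomputable def affDim {n : ℕ} (F : Set (Fin n → ℝ)) : ℕ :=
  Module.finrank ℝ (vectorSpan ℝ F)

/-- The vertices of a polytope are its extreme points. -/
def polytopeVertices {n : ℕ} (P : Set (Fin n → ℝ)) : Set (Fin n → ℝ) :=
  P.extremePoints ℝ

/-- A nonempty face of `Q`: the nonempty set of maximizers over `Q` of some linear functional.
The polytope itself counts as a face (take the zero functional). -/
def IsNonemptyFace {n : ℕ} (Q F : Set (Fin n → ℝ)) : Prop :=
  F.Nonempty ∧ IsExposed ℝ Q F

/-- A nonempty face of codimension `k`. -/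
def IsFaceOfCodim {n : ℕ} (Q : Set (Fin n → ℝ)) (k : ℕ) (F : Set (Fin n → ℝ)) : Prop :=
  IsNonemptyFace Q F ∧ affDim F + k = affDim Q

/-- A facet is a face of codimension one. -/
def IsFacet {n : ℕ} (Q F : Set (Fin n → ℝ)) : Prop := IsFaceOfCodim Q 1 F

/-- A ridge is a face of codimension two. -/
def IsRidge {n : ℕ} (Q F : Set (Fin n → ℝ)) : Prop := IsFaceOfCodim Q 2 F

/-- An `n`-dimensional smooth Fano polytope in `ℝⁿ`: an `n`-dimensional lattice polytope with the
origin in its interior, with primitive vertices, such that every facet has exactly `n` vertices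
and these form a basis of the lattice. -/
structure IsSmoothFano {n : ℕ} (P : Set (Fin n → ℝ)) : Prop where
  latticePolytope : IsLatticePolytope P
  dim_eq : affDim P = n
  zero_mem_interior : (0 : Fin n → ℝ) ∈ interior P
  primitive : ∀ v ∈ polytopeVertices P, IsPrimitivePoint v
  simplicial : ∀ F, IsFacet P F → (polytopeVertices F).ncard = n
  smooth : ∀ F, IsFacet P F → IsLatticeBasis (polytopeVertices F)

/-- Any `n` vertices either form a basis of the lattice or are linearly dependent. -/
def IsUnimodularPolytope {n : ℕ} (P : Set (Fin n → ℝ)) : Prop :=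
  ∀ S : Finset (Fin n → ℝ), (S : Set (Fin n → ℝ)) ⊆ polytopeVertices P → S.card = n →
    IsLatticeBasis (S : Set (Fin n → ℝ)) ∨
      ¬ LinearIndepOn ℝ id (S : Set (Fin n → ℝ))

/-- A unimodular smooth Fano polytope. -/
def IsUSFP {n : ℕ} (P : Set (Fin n → ℝ)) : Prop :=
  IsSmoothFano P ∧ IsUnimodularPolytope P

/-- The dual polytope. -/
def dualPolytope {n : ℕ} (P : Set (Fin n → ℝ)) : Set (Fin n → ℝ) :=
  {x | ∀ y ∈ P, -1 ≤ x ⬝ᵥ y}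

/-- A linear map given by an integer matrix of determinant `±1`. -/
def IsUnimodularMap {n : ℕ} (φ : (Fin n → ℝ) →ₗ[ℝ] (Fin n → ℝ)) : Prop :=
  ∃ A : Matrix (Fin n) (Fin n) ℤ, (A.det = 1 ∨ A.det = -1) ∧
    φ = Matrix.toLin' (A.map (fun z : ℤ => (z : ℝ)))

/-- The strong Ewald condition. -/
def StrongEwald {n : ℕ} (P : Set (Fin n → ℝ)) : Prop :=
  ∀ v ∈ polytopeVertices P, ∃ φ : (Fin n → ℝ) →ₗ[ℝ] (Fin n → ℝ),
    IsUnimodularMap φ ∧ (∀ x ∈ P, ∀ i, φ x i ∈ Set.Icc (-1 : ℝ) 1) ∧ φ v = fun _ => 1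

/-- The symmetric lattice points `Q ∩ (-Q) ∩ ℤⁿ` of `Q`. -/
def symmetricPoints {n : ℕ} (Q : Set (Fin n → ℝ)) : Set (Fin n → ℝ) :=
  Q ∩ (-Q) ∩ (stdLattice n : Set (Fin n → ℝ))

/-- `Star(f)`: the union of all facets of `Q` containing `f`. -/
def bigStar {n : ℕ} (Q f : Set (Fin n → ℝ)) : Set (Fin n → ℝ) :=
  ⋃₀ {F | IsFacet Q F ∧ f ⊆ F}

/-- `star(f)`: the union of all ridges of `Q` containing `f`. -/
def smallStar {n : ℕ} (Q f : Set (Fin n → ℝ)) : Set (Fin n → ℝ) :=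
  ⋃₀ {R | IsRidge Q R ∧ f ⊆ R}

/-- The star Ewald condition for one face `f` of `Q`, where `Star*(f) = Star(f) \ star(f)`. -/
def StarEwaldAt {n : ℕ} (Q f : Set (Fin n → ℝ)) : Prop :=
  ∃ l ∈ symmetricPoints Q, l ∈ bigStar Q f \ smallStar Q f ∧ -l ∉ bigStar Q f

/-- The star Ewald condition: it holds at every nonempty proper face. -/
def StarEwald {n : ℕ} (Q : Set (Fin n → ℝ)) : Prop :=
  ∀ f, IsNonemptyFace Q f → f ≠ Q → StarEwaldAt Q f

/-! Everything is read off in coordinates with respect to the vertices of one facet, which form a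
lattice basis. By Cramer's rule, the minors of the coordinate matrix of the other vertices are
determinants of `n`-tuples of vertices, so unimodularity forces them into {-1, 0, 1}. Only sizes one
and two are needed: coordinates are 0 or ±1 (`repr_vertex_mem`), and no 2×2 minor is ±2
(`no_two_by_two_minor_of_abs_two`).

Strong Ewald: take a facet through v, with v the basis vector of index i₀. For each other index i,
the sum or the difference of coordinates i₀ and i stays in [-1, 1] on all vertices, since otherwise
a minor ±2 would appear. These combinations, together with coordinate i₀, form the required map.

Star Ewald: a proper face f of the dual is tight at some vertex v. Choose a facet of P containing
all vertices tight at a point of f; then λ is minus the coordinate functional of v. Both λ and -λ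
lie in the dual by the bound on coordinates. Stars are controlled by `face_structure`, which
describes the faces of the dual by their tight vertices. -/

namespace USFP

/-! ### Lattice points and dot-product functionals -/

lemma mem_stdLattice_iff {n : ℕ} (x : Fin n → ℝ) :
    x ∈ stdLattice n ↔ ∀ i, ∃ z : ℤ, x i = z := by
  rw [stdLattice, Module.Basis.mem_span_iff_repr_mem]
  simp [eq_comm]

/-- The functional `x ↦ x ⬝ᵥ v`. -/
noncomputable def dotLeft {n : ℕ} (v : Fin n → ℝ) : Module.Dual ℝ (Fin n → ℝ) where
  toFun x := x ⬝ᵥ v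
  map_add' x y := add_dotProduct x y v
  map_smul' c x := by simp

@[simp] lemma dotLeft_apply {n : ℕ} (v x : Fin n → ℝ) : dotLeft v x = x ⬝ᵥ v := rfl

lemma dotLeft_ne_zero {n : ℕ} {v : Fin n → ℝ} (hv : v ≠ 0) : dotLeft v ≠ 0 := by
  intro h
  have := LinearMap.congr_fun h v
  simp [dotProduct_self_eq_zero] at this
  exact hv this

lemma continuous_dot {n : ℕ} (v : Fin n → ℝ) : Continuous fun x : Fin n → ℝ => x ⬝ᵥ v :=
  (dotLeft v).continuous_of_finiteDimensional

lemma finrank_ker_dotLeft {n : ℕ} {v : Fin n → ℝ} (hv : v ≠ 0) :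
    Module.finrank ℝ (LinearMap.ker (dotLeft v)) + 1 = n := by
  have := Module.Dual.finrank_ker_add_one_of_ne_zero (dotLeft_ne_zero hv)
  simpa using this

lemma dual_apply_eq_dotProduct {n : ℕ} (f : Module.Dual ℝ (Fin n → ℝ)) (y : Fin n → ℝ) :
    f y = (fun i => f (Pi.single i 1)) ⬝ᵥ y := by
  conv_lhs => rw [pi_eq_sum_univ' y]
  rw [map_sum, dotProduct]
  refine Finset.sum_congr rfl fun i _ => ?_
  rw [map_smul, smul_eq_mul, mul_comm]

/-! ### Lattice bases -/

/-- The integer span contains the standard basis, so the `n` vectors span ℝⁿ and hence form a real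
basis. Membership in their integer span makes the coordinates of lattice points integers. -/
lemma exists_basis_of_isLatticeBasis {n : ℕ} {B : Set (Fin n → ℝ)} (hB : IsLatticeBasis B)
    (hcard : B.ncard = n) (hfin : B.Finite) :
    ∃ b : Module.Basis (Fin n) ℝ (Fin n → ℝ), Set.range b = B ∧
      ∀ x ∈ stdLattice n, ∀ i, ∃ z : ℤ, b.repr x i = z := by
  have : Fintype B := hfin.fintype
  have hc : Fintype.card B = n := by
    rw [← Set.toFinset_card, ← Set.ncard_eq_toFinset_card', hcard]
  let e : Fin n ≃ B := (Fintype.equivFinOfCardEq hc).symm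
  have hr : Set.range (fun i => (e i : Fin n → ℝ)) = B := by
    ext x
    constructor
    · rintro ⟨i, rfl⟩; exact (e i).2
    · intro hx; exact ⟨e.symm ⟨x, hx⟩, by simp⟩
  have hspan : ⊤ ≤ Submodule.span ℝ (Set.range (fun i => (e i : Fin n → ℝ))) := by
    rw [hr, ← (Pi.basisFun ℝ (Fin n)).span_eq, Submodule.span_le]
    intro x hx
    have h1 : x ∈ Submodule.span ℤ B := by
      rw [hB.2]; exact Submodule.subset_span hx
    exact Submodule.span_le_restrictScalars ℤ ℝ B h1
  let b := basisOfTopLeSpanOfCardEqFinrank _ hspan (by simp)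
  have hb : (b : Fin n → Fin n → ℝ) = fun i => (e i : Fin n → ℝ) :=
    coe_basisOfTopLeSpanOfCardEqFinrank _ _ _
  have hrb : Set.range b = B := by rw [hb, hr]
  refine ⟨b, hrb, fun x hx i => ?_⟩
  rw [← hB.2, ← hrb, Module.Basis.mem_span_iff_repr_mem] at hx
  obtain ⟨z, hz⟩ := hx i
  exact ⟨z, by simp [← hz]⟩

/-- Linearly independent `n`-tuples of vertices of a unimodular polytope generate `ℤⁿ`. -/
lemma exists_int_combination {n : ℕ} {P : Set (Fin n → ℝ)} (hP : IsUnimodularPolytope P)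
    {g : Fin n → Fin n → ℝ} (hg : ∀ i, g i ∈ polytopeVertices P) (hli : LinearIndependent ℝ g)
    {x : Fin n → ℝ} (hx : x ∈ stdLattice n) : ∃ a : Fin n → ℤ, x = ∑ i, (a i : ℝ) • g i := by
  classical
  have hS : ((Finset.univ.image g : Finset _) : Set (Fin n → ℝ)) = Set.range g := by simp
  rcases hP (Finset.univ.image g) (by rw [hS]; rintro _ ⟨i, rfl⟩; exact hg i)
    (by rw [Finset.card_image_of_injective _ hli.injective]; simp) with h | h
  · rw [hS] at h
    rw [← h.2, Submodule.mem_span_range_iff_exists_fun] at hx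
    obtain ⟨a, ha⟩ := hx
    exact ⟨a, by rw [← ha]; simp only [Int.cast_smul_eq_zsmul]⟩
  · rw [hS] at h
    exact absurd hli.linearIndepOn_id h

/-- Vertices have coordinates in `{-1, 0, 1}` with respect to a basis of vertices. -/
lemma repr_vertex_mem {n : ℕ} {P : Set (Fin n → ℝ)} (hP : IsUnimodularPolytope P)
    (b : Module.Basis (Fin n) ℝ (Fin n → ℝ)) (hb : ∀ i, b i ∈ polytopeVertices P)
    (hlat : ∀ x ∈ polytopeVertices P, x ∈ stdLattice n)
    (hint : ∀ x ∈ stdLattice n, ∀ i, ∃ z : ℤ, b.repr x i = z)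
    {x : Fin n → ℝ} (hx : x ∈ polytopeVertices P) (i : Fin n) :
    b.repr x i = 0 ∨ b.repr x i = 1 ∨ b.repr x i = -1 := by
  classical
  by_cases h0 : b.repr x i = 0
  · exact Or.inl h0
  right
  -- Replacing `b i` by x gives a family whose determinant relative to `b` is the coordinate `b.repr
  -- x i`; it is independent when that coordinate is nonzero.
  have key : ∀ (a : Fin n → ℝ) (k : Fin n),
      b.repr (∑ j, a j • Function.update b i x j) k =
        (if k = i then 0 else a k) + a i * b.repr x k := by
    intro a k
    rw [map_sum, Finsupp.finsetSum_apply, ← Finset.add_sum_erase _ _ (Finset.mem_univ i)]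
    rw [Finset.sum_congr rfl (g := fun j => if j = k then a j else 0)]
    · rw [Finset.sum_ite_eq']
      by_cases hk : k = i <;> simp [hk, add_comm]
    · intro j hj
      simp [Finset.ne_of_mem_erase hj, Finsupp.single_apply]
  have hli : LinearIndependent ℝ (Function.update b i x) := by
    rw [Fintype.linearIndependent_iff]
    intro a ha
    have hz : ∀ k, (if k = i then 0 else a k) + a i * b.repr x k = 0 := by
      intro k; rw [← key, ha]; simp
    have hi : a i = 0 := by
      have := hz i; simp [h0] at this; exact this
    intro k
    by_cases hk : k = i
    · rw [hk, hi]
    · have := hz k; simpa [hk, hi] using this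
  obtain ⟨a, ha⟩ := exists_int_combination hP
    (g := Function.update b i x) (by
      intro j
      by_cases hj : j = i
      · subst hj; simpa using hx
      · simpa [hj] using hb j) hli (hlat _ (hb i))
  -- Comparing the i-th coordinates of `b i` and its integer expansion writes 1 as a product of two
  -- integers, one of which is `b.repr x i`.
  have h1 := key (fun j => (a j : ℝ)) i
  rw [← ha] at h1
  obtain ⟨z, hz⟩ := hint x (hlat x hx) i
  rw [hz] at h1 ⊢
  have h2 : a i * z = 1 := by
    simp at h1; exact_mod_cast h1.symm
  rcases Int.eq_one_or_neg_one_of_mul_eq_one' h2 with h | h <;> simp [h.2]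

/-- Coordinates of two vertices with respect to a basis of vertices have no minor `±2`. -/
lemma no_two_by_two_minor_of_abs_two {n : ℕ} {P : Set (Fin n → ℝ)} (hP : IsUnimodularPolytope P)
    (b : Module.Basis (Fin n) ℝ (Fin n → ℝ)) (hb : ∀ i, b i ∈ polytopeVertices P)
    (hlat : ∀ x ∈ polytopeVertices P, x ∈ stdLattice n)
    {x y : Fin n → ℝ} (hx : x ∈ polytopeVertices P) (hy : y ∈ polytopeVertices P)
    {i j : Fin n} (hij : i ≠ j)
    (h1 : b.repr x i = b.repr x j) (h2 : b.repr y i = -b.repr y j)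
    (hx1 : b.repr x i = 1 ∨ b.repr x i = -1) (hy1 : b.repr y i = 1 ∨ b.repr y i = -1) :
    False := by
  classical
  -- With x and y in places i and j, the determinant relative to `b` is ±2: the family is
  -- independent but cannot generate the lattice.
  set g : Fin n → Fin n → ℝ := Function.update (Function.update b i x) j y with hg
  have gi : g i = x := by simp [hg, hij]
  have gj : g j = y := by simp [hg]
  have gk : ∀ k, k ≠ i → k ≠ j → g k = b k := by
    intro k h h'; simp [hg, h, h']
  have key : ∀ (a : Fin n → ℝ) (k : Fin n),
      b.repr (∑ j, a j • g j) k =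
        (if k = i ∨ k = j then 0 else a k) + a i * b.repr x k + a j * b.repr y k := by
    intro a k
    rw [map_sum, Finsupp.finsetSum_apply, ← Finset.add_sum_erase _ _ (Finset.mem_univ i),
      ← Finset.add_sum_erase _ _ (Finset.mem_erase.2 ⟨hij.symm, Finset.mem_univ j⟩)]
    rw [Finset.sum_congr rfl (g := fun l => if l = k then a l else 0)]
    · rw [Finset.sum_ite_eq', gi, gj]
      by_cases hk : k = i <;> by_cases hk' : k = j <;> (simp [hk, hk']; try ring)
    · intro l hl
      have hlj := Finset.ne_of_mem_erase hl
      have hli := Finset.ne_of_mem_erase (Finset.mem_of_mem_erase hl)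
      simp [gk l hli hlj, Finsupp.single_apply]
  have hli : LinearIndependent ℝ g := by
    rw [Fintype.linearIndependent_iff]
    intro a ha
    have hz : ∀ k, (if k = i ∨ k = j then 0 else a k) + a i * b.repr x k + a j * b.repr y k = 0 := by
      intro k; rw [← key, ha]; simp
    have e1 := hz i
    have e2 := hz j
    simp only [true_or, or_true, if_true, zero_add] at e1 e2
    rw [← h1] at e2
    have h2' : b.repr y j = -b.repr y i := by linarith
    rw [h2'] at e2
    have hai : a i = 0 := by
      rcases hx1 with h | h <;> rw [h] at e1 e2 <;> linarith
    have haj : a j = 0 := by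
      rcases hy1 with h | h <;> rw [h] at e1 e2 <;> linarith
    intro k
    by_cases hk : k = i
    · rw [hk, hai]
    by_cases hk' : k = j
    · rw [hk', haj]
    have := hz k
    simpa [hk, hk', hai, haj] using this
  obtain ⟨a, ha⟩ := exists_int_combination hP (g := g) (by
      intro k
      by_cases hk : k = i
      · rw [hk, gi]; exact hx
      by_cases hk' : k = j
      · rw [hk', gj]; exact hy
      rw [gk k hk hk']; exact hb k) hli (hlat _ (hb i))
  have e1 := key (fun j => (a j : ℝ)) i
  have e2 := key (fun j => (a j : ℝ)) j
  rw [← ha] at e1 e2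
  simp only [true_or, or_true, if_true, zero_add, Module.Basis.repr_self, Finsupp.single_eq_same,
    Finsupp.single_eq_of_ne hij.symm] at e1 e2
  have h2' : b.repr y j = -b.repr y i := by linarith
  rw [← h1, h2'] at e2
  -- Adding the two coordinate equations of `b i` cancels the y terms and leaves twice an integer
  -- equal to 1.
  have parity : ∃ m : ℤ, (m : ℝ) * 2 = 1 := by
    rcases hx1 with h | h
    · exact ⟨a i, by rw [h] at e1 e2; linarith⟩
    · exact ⟨-a i, by rw [h] at e1 e2; push_cast; linarith⟩
  obtain ⟨m, hm⟩ := parity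
  have : m * 2 = 1 := by exact_mod_cast hm
  omega

/-! ### Vertices and the dual polytope -/

section polytope

variable {n : ℕ} {P : Set (Fin n → ℝ)}

lemma vertices_finite (h : IsLatticePolytope P) : (polytopeVertices P).Finite := by
  obtain ⟨S, -, rfl⟩ := h
  exact S.finite_toSet.subset extremePoints_convexHull_subset

lemma vertices_lattice (h : IsLatticePolytope P) :
    ∀ x ∈ polytopeVertices P, x ∈ stdLattice n := by
  obtain ⟨S, hS, rfl⟩ := h
  exact fun x hx => hS x (extremePoints_convexHull_subset hx)

lemma convexHull_vertices (h : IsLatticePolytope P) : convexHull ℝ (polytopeVertices P) = P := by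
  have hfin := vertices_finite h
  have hcl : IsClosed (convexHull ℝ (polytopeVertices P)) := hfin.isClosed_convexHull ℝ
  obtain ⟨S, hS, rfl⟩ := h
  have := closure_convexHull_extremePoints (S.finite_toSet.isCompact_convexHull ℝ)
    (convex_convexHull ℝ (S : Set (Fin n → ℝ)))
  rwa [← polytopeVertices, hcl.closure_eq] at this

/-- A half-space containing the vertices contains the polytope. -/
lemma forall_le_of_vertices (h : IsLatticePolytope P) {x : Fin n → ℝ} {c : ℝ}
    (hx : ∀ v ∈ polytopeVertices P, c ≤ x ⬝ᵥ v) : ∀ y ∈ P, c ≤ x ⬝ᵥ y := by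
  intro y hy
  rw [← convexHull_vertices h] at hy
  have hc : Convex ℝ {y : Fin n → ℝ | c ≤ dotLeft x y} :=
    convex_halfSpace_ge (dotLeft x).isLinear c
  have := convexHull_min (s := polytopeVertices P) (fun v hv => by
    show c ≤ dotLeft x v
    rw [dotLeft_apply, dotProduct_comm]; exact hx v hv) hc hy
  rw [Set.mem_ofPred_eq, dotLeft_apply, dotProduct_comm] at this
  exact this

lemma mem_dual_iff (h : IsLatticePolytope P) (x : Fin n → ℝ) :
    x ∈ dualPolytope P ↔ ∀ v ∈ polytopeVertices P, -1 ≤ x ⬝ᵥ v :=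
  ⟨fun hx v hv => hx v hv.1, fun hx => forall_le_of_vertices h hx⟩

lemma convex_dual : Convex ℝ (dualPolytope P) := by
  have : dualPolytope P = ⋂ y ∈ P, {x | -1 ≤ dotLeft y x} := by
    ext x; simp [dualPolytope]
  rw [this]
  exact convex_iInter₂ fun y _ => convex_halfSpace_ge (dotLeft y).isLinear (-1)

/-- Otherwise d would be nonnegative on P, which contains a small negative multiple of d. -/
lemma exists_vertex_neg (h : IsLatticePolytope P) (h0 : (0 : Fin n → ℝ) ∈ interior P)
    {d : Fin n → ℝ} (hd : d ≠ 0) : ∃ v ∈ polytopeVertices P, d ⬝ᵥ v < 0 := by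
  by_contra! hcon
  have hall := forall_le_of_vertices h hcon
  have hcont : Filter.Tendsto (fun t : ℝ => t • d) (nhds 0) (nhds 0) := by
    have : Continuous fun t : ℝ => t • d := by fun_prop
    simpa using this.tendsto 0
  have hev := (hcont.eventually (mem_interior_iff_mem_nhds.1 h0)).filter_mono
    (nhdsWithin_le_nhds (s := Set.Iio 0))
  obtain ⟨t, htP, ht⟩ := (hev.and self_mem_nhdsWithin).exists
  have h1 := hall _ htP
  rw [dotProduct_smul, smul_eq_mul] at h1
  have h2 : 0 < d ⬝ᵥ d := by
    refine lt_of_le_of_ne (Finset.sum_nonneg fun i _ => mul_self_nonneg (d i)) fun h => ?_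
    exact hd (dotProduct_self_eq_zero.1 h.symm)
  have ht' : t < 0 := ht
  nlinarith

/-- Every vertex lies on a supporting hyperplane at height `-1`. -/
lemma exists_dual_tight (hconv : Convex ℝ P) (h0 : (0 : Fin n → ℝ) ∈ interior P)
    {v : Fin n → ℝ} (hv : v ∈ polytopeVertices P) (hv0 : v ≠ 0) :
    ∃ x ∈ dualPolytope P, x ⬝ᵥ v = -1 := by
  -- If v were interior, a slightly longer multiple of v would lie in P, and v would be inside the
  -- segment joining it to 0.
  have hvi : v ∉ interior P := by
    intro hvi
    have hcont : Filter.Tendsto (fun t : ℝ => (1 + t) • v) (nhds 0) (nhds v) := by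
      have : Continuous fun t : ℝ => (1 + t) • v := by fun_prop
      simpa using this.tendsto 0
    have hev := (hcont.eventually (mem_interior_iff_mem_nhds.1 hvi)).filter_mono
      (nhdsWithin_le_nhds (s := Set.Ioi 0))
    obtain ⟨t, htP, ht⟩ := (hev.and self_mem_nhdsWithin).exists
    have ht' : 0 < t := ht
    have hseg : v ∈ openSegment ℝ (0 : Fin n → ℝ) ((1 + t) • v) := by
      refine ⟨t / (1 + t), 1 / (1 + t), by positivity, by positivity, by field_simp; ring, ?_⟩
      rw [smul_zero, zero_add, smul_smul, one_div, inv_mul_cancel₀ (by positivity), one_smul]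
    exact hv0 (hv.2 (interior_subset h0) htP hseg).symm
  obtain ⟨f, hf⟩ := geometric_hahn_banach_open_point hconv.interior isOpen_interior hvi
  have hle : ∀ y ∈ P, f y ≤ f v := by
    intro y hy
    have hy' : y ∈ closure (interior P) := by
      rw [hconv.closure_interior_eq_closure_of_nonempty_interior ⟨0, h0⟩]
      exact subset_closure hy
    have hcl : IsClosed {y | f y ≤ f v} := isClosed_le f.continuous continuous_const
    exact closure_minimal (fun z hz => (hf z hz).le) hcl hy'
  have hpos : 0 < f v := by simpa using hf 0 h0
  have hrep : ∀ y, f y = (fun i => f (Pi.single i 1)) ⬝ᵥ y := dual_apply_eq_dotProduct f.toLinearMap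
  refine ⟨(-(f v)⁻¹) • fun i => f (Pi.single i 1), fun y hy => ?_, ?_⟩
  · rw [smul_dotProduct, ← hrep, smul_eq_mul]
    have := hle y hy
    have h3 : (f v)⁻¹ * f y ≤ 1 := by
      rw [inv_mul_le_iff₀ hpos]; linarith
    linarith
  · rw [smul_dotProduct, ← hrep, smul_eq_mul, neg_mul, inv_mul_cancel₀ hpos.ne']

/-- The vertices at which `x` takes the value `-1`. -/
def tightVertices (P : Set (Fin n → ℝ)) (x : Fin n → ℝ) : Set (Fin n → ℝ) :=
  {v ∈ polytopeVertices P | x ⬝ᵥ v = -1}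

/-- Unless the tight vertices span, a point of the dual can be moved so as to have more of them. -/
lemma exists_tightVertices_ssubset (h : IsLatticePolytope P)
    (h0 : (0 : Fin n → ℝ) ∈ interior P) {x : Fin n → ℝ} (hx : x ∈ dualPolytope P)
    (hspan : Submodule.span ℝ (tightVertices P x) ≠ ⊤) :
    ∃ y ∈ dualPolytope P, tightVertices P x ⊂ tightVertices P y := by
  obtain ⟨f, hf0, hf⟩ := Submodule.exists_le_ker_of_lt_top _ (lt_top_iff_ne_top.2 hspan)
  set d : Fin n → ℝ := fun i => f (Pi.single i 1)
  have hrep : ∀ y, f y = d ⬝ᵥ y := dual_apply_eq_dotProduct f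
  have hd0 : d ≠ 0 := by
    intro h; apply hf0; ext1 i; ext; simp [hrep, h]
  have hperp : ∀ v ∈ tightVertices P x, d ⬝ᵥ v = 0 := by
    intro v hv
    rw [← hrep]
    exact hf (Submodule.subset_span hv)
  have hfin : {v ∈ polytopeVertices P | d ⬝ᵥ v < 0}.Finite :=
    (vertices_finite h).subset (Set.sep_subset _ _)
  obtain ⟨w, hw, hmin⟩ := Set.exists_min_image _ (fun v => (x ⬝ᵥ v + 1) / (-(d ⬝ᵥ v))) hfin
    (by obtain ⟨v, hv, hv'⟩ := exists_vertex_neg h h0 hd0; exact ⟨v, hv, hv'⟩)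
  -- The ratio test: the largest step along d that stays in the dual, stopped by the constraint of
  -- w.
  set t := (x ⬝ᵥ w + 1) / (-(d ⬝ᵥ w)) with ht
  have hw2 : d ⬝ᵥ w < 0 := hw.2
  have ht0 : 0 ≤ t := div_nonneg (by linarith [hx w hw.1.1]) (by linarith)
  have heval : ∀ v, (x + t • d) ⬝ᵥ v = x ⬝ᵥ v + t * (d ⬝ᵥ v) := by
    intro v; simp [add_dotProduct]
  have hwt : (x + t • d) ⬝ᵥ w = -1 := by
    rw [heval, ht]
    field_simp [hw2.ne]
    ring
  refine ⟨x + t • d, (mem_dual_iff h _).2 fun v hv => ?_, ?_⟩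
  · rw [heval]
    have hxv := hx v hv.1
    by_cases hdv : d ⬝ᵥ v < 0
    · have h3 := hmin v ⟨hv, hdv⟩
      change t ≤ _ at h3
      rw [le_div_iff₀ (by linarith)] at h3
      linarith
    · have := mul_nonneg ht0 (not_lt.1 hdv)
      linarith
  · rw [Set.ssubset_iff_of_subset]
    · exact ⟨w, ⟨hw.1, hwt⟩, fun hcon => hw2.ne (hperp w hcon)⟩
    · intro v hv
      refine ⟨hv.1, ?_⟩
      rw [heval, hperp v hv, hv.2]; ring

/-- There are finitely many candidate tight sets, and a maximal one must span by the previous lemma.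
-/
lemma exists_spanning_tightVertices (h : IsLatticePolytope P)
    (h0 : (0 : Fin n → ℝ) ∈ interior P) {x : Fin n → ℝ} (hx : x ∈ dualPolytope P) :
    ∃ y ∈ dualPolytope P, tightVertices P x ⊆ tightVertices P y ∧
      Submodule.span ℝ (tightVertices P y) = ⊤ := by
  have hfin : {T | ∃ y ∈ dualPolytope P, tightVertices P x ⊆ tightVertices P y ∧
      T = tightVertices P y}.Finite := by
    refine (vertices_finite h).finite_subsets.subset ?_
    rintro _ ⟨y, -, -, rfl⟩
    exact Set.sep_subset _ _
  obtain ⟨T, hT⟩ := hfin.exists_maximal ⟨_, x, hx, subset_rfl, rfl⟩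
  obtain ⟨y, hy, hxy, rfl⟩ := hT.1
  refine ⟨y, hy, hxy, ?_⟩
  by_contra hne
  obtain ⟨z, hz, hyz⟩ := exists_tightVertices_ssubset h h0 hy hne
  exact hyz.2 (hT.2 ⟨z, hz, hxy.trans hyz.1, rfl⟩ hyz.1)

/-- Vertices tight at a common point of the dual lie on a common facet; its vertices are the tight
vertices of some point of the dual. -/
lemma exists_facet (h : IsLatticePolytope P) (hdim : affDim P = n)
    (h0 : (0 : Fin n → ℝ) ∈ interior P) {x : Fin n → ℝ} (hx : x ∈ dualPolytope P)
    (hne : (tightVertices P x).Nonempty) :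
    ∃ G, IsFacet P G ∧ ∃ y ∈ dualPolytope P, tightVertices P x ⊆ tightVertices P y ∧
      polytopeVertices G = tightVertices P y := by
  obtain ⟨y, hy, hxy, hspan⟩ := exists_spanning_tightVertices h h0 hx
  obtain ⟨v, hv⟩ := hne.mono hxy
  set G := {z ∈ P | y ⬝ᵥ z = -1} with hG
  have hexp : IsExposed ℝ P G := by
    intro _
    refine ⟨-(LinearMap.toContinuousLinearMap (dotLeft y)), ?_⟩
    ext z
    constructor
    · rintro ⟨hz, hz1⟩
      refine ⟨hz, fun u hu => ?_⟩
      have := hy u hu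
      simp [dotProduct_comm _ y, hz1]; linarith
    · rintro ⟨hz, hz1⟩
      refine ⟨hz, le_antisymm ?_ (hy z hz)⟩
      have := hz1 v hv.1.1
      simp [dotProduct_comm _ y, hv.2] at this
      linarith
  have hvG : v ∈ G := ⟨hv.1.1, hv.2⟩
  have hy0 : y ≠ 0 := by
    rintro rfl
    have := hv.2
    simp at this
  have hdimG : affDim G + 1 = n := by
    apply le_antisymm
    · refine le_of_le_of_eq (Nat.add_le_add_right (Submodule.finrank_mono ?_) 1)
        (finrank_ker_dotLeft hy0)
      rw [vectorSpan_def, Submodule.span_le]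
      rintro _ ⟨a, ha, c, hc, rfl⟩
      simp [dotProduct_comm _ y, ha.2, hc.2, dotProduct_sub]
    -- The tight vertices span ℝⁿ, and each is v plus a direction of `G`; hence `G` loses at most
    -- one dimension.
    · have htop : (⊤ : Submodule ℝ (Fin n → ℝ)) ≤ vectorSpan ℝ G ⊔ Submodule.span ℝ {v} := by
        rw [← hspan, Submodule.span_le]
        intro u hu
        have hu' : u = (u - v) + v := by abel
        rw [hu']
        exact Submodule.add_mem_sup (vsub_mem_vectorSpan ℝ ⟨hu.1.1, hu.2⟩ hvG)
          (Submodule.mem_span_singleton_self v)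
      have h1 := Submodule.finrank_mono htop
      have h2 := Submodule.finrank_add_le_finrank_add_finrank (vectorSpan ℝ G)
        (Submodule.span ℝ {v})
      have h3 : Module.finrank ℝ (Submodule.span ℝ {v}) ≤ 1 := by
        simpa using finrank_span_le_card (R := ℝ) ({v} : Set (Fin n → ℝ))
      rw [finrank_top, Module.finrank_fin_fun] at h1
      unfold affDim
      omega
  refine ⟨G, ⟨⟨⟨v, hvG⟩, hexp⟩, by rw [hdimG, hdim]⟩, y, hy, hxy, ?_⟩
  rw [polytopeVertices, hexp.isExtreme.extremePoints_eq]
  ext z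
  constructor
  · rintro ⟨hz, hz'⟩; exact ⟨hz', hz.2⟩
  · rintro ⟨hz, hz'⟩; exact ⟨⟨hz.1, hz'⟩, hz⟩

/-! ### Faces of the dual polytope -/

/-- The vertices of `P` that are tight on all of `F`. -/
def commonTight (P F : Set (Fin n → ℝ)) : Set (Fin n → ℝ) :=
  {v ∈ polytopeVertices P | ∀ x ∈ F, x ⬝ᵥ v = -1}

/-- A midpoint is strict at every vertex where either endpoint is strict, so finitely many
constraints can be treated one at a time. -/
lemma exists_relative_interior_point {F : Set (Fin n → ℝ)} (hF : F ⊆ dualPolytope P)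
    (hconv : Convex ℝ F) (hne : F.Nonempty) {U : Set (Fin n → ℝ)} (hU : U.Finite)
    (hUP : U ⊆ polytopeVertices P) (hUF : ∀ v ∈ U, ∃ y ∈ F, y ⬝ᵥ v ≠ -1) :
    ∃ x ∈ F, ∀ v ∈ U, -1 < x ⬝ᵥ v := by
  induction U, hU using Set.Finite.induction_on with
  | empty => obtain ⟨x, hx⟩ := hne; exact ⟨x, hx, by simp⟩
  | @insert a s ha hs ih =>
    obtain ⟨x, hx, hxs⟩ := ih ((Set.subset_insert _ _).trans hUP)
      fun v hv => hUF v (Set.mem_insert_of_mem _ hv)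
    obtain ⟨y, hy, hya⟩ := hUF a (Set.mem_insert _ _)
    have hya' : -1 < y ⬝ᵥ a := lt_of_le_of_ne (hF hy a (hUP (Set.mem_insert _ _)).1) (Ne.symm hya)
    refine ⟨(1 / 2 : ℝ) • x + (1 / 2 : ℝ) • y,
      hconv hx hy (by norm_num) (by norm_num) (by norm_num), ?_⟩
    intro v hv
    rw [add_dotProduct, smul_dotProduct, smul_dotProduct, smul_eq_mul, smul_eq_mul]
    have hxv := hF hx v (hUP hv).1
    have hyv := hF hy v (hUP hv).1
    rcases hv with rfl | hv
    · linarith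
    · linarith [hxs v hv]

/-- The direction of a face of the dual is the orthogonal complement of its tight vertices, and only
the whole dual polytope has none. -/
lemma face_structure (h : IsLatticePolytope P) {F : Set (Fin n → ℝ)}
    (hF : IsNonemptyFace (dualPolytope P) F) :
    (∀ d, d ∈ vectorSpan ℝ F ↔ ∀ v ∈ commonTight P F, d ⬝ᵥ v = 0) ∧
      (commonTight P F = ∅ → F = dualPolytope P) := by
  obtain ⟨l, hl⟩ := hF.2 hF.1
  have hsub : F ⊆ dualPolytope P := hF.2.subset
  obtain ⟨x, hx, hxt⟩ := exists_relative_interior_point hsub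
    (hF.2.convex convex_dual) hF.1 (U := polytopeVertices P \ commonTight P F)
    ((vertices_finite h).subset Set.sdiff_subset) Set.sdiff_subset (by
      rintro v ⟨hv, hv'⟩
      by_contra! hcon
      exact hv' ⟨hv, hcon⟩)
  -- Constraints outside the common tight set are strict at x, so x can move both ways along d. As x
  -- maximizes `l`, this forces `l d = 0`, and the moved point stays in the face.
  have hmove : ∀ d, (∀ v ∈ commonTight P F, d ⬝ᵥ v = 0) →
      ∃ t : ℝ, 0 < t ∧ x + t • d ∈ F ∧ l d = 0 := by
    intro d hd
    have hev : ∀ᶠ t : ℝ in nhds 0, x + t • d ∈ dualPolytope P := by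
      simp only [mem_dual_iff h]
      rw [Filter.eventually_all_finite (vertices_finite h)]
      intro v hv
      by_cases hvT : v ∈ commonTight P F
      · refine Filter.Eventually.of_forall fun t => ?_
        rw [add_dotProduct, smul_dotProduct, hd v hvT, hvT.2 x hx]
        simp
      · have hc : Continuous fun t : ℝ => (x + t • d) ⬝ᵥ v :=
          (continuous_dot v).comp (by fun_prop)
        have := (hc.tendsto 0).eventually (lt_mem_nhds (a := -1) (by
          simpa using hxt v ⟨hv, hvT⟩))
        exact this.mono fun t ht => ht.le
    have hneg : Filter.Tendsto (fun t : ℝ => -t) (nhds 0) (nhds 0) := by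
      simpa using (continuous_neg (G := ℝ)).tendsto 0
    have hev2 := (hev.and (hneg.eventually hev)).filter_mono
      (nhdsWithin_le_nhds (s := Set.Ioi 0))
    obtain ⟨t, ⟨h1, h2⟩, ht⟩ := (hev2.and self_mem_nhdsWithin).exists
    have ht' : 0 < t := ht
    rw [hl] at hx
    have e1 := hx.2 _ h1
    have e2 := hx.2 _ h2
    simp only [map_add, map_smul, smul_eq_mul] at e1 e2
    have hld : l d = 0 := by
      have : t * l d = 0 := by linarith
      exact (mul_eq_zero.1 this).resolve_left ht'.ne'
    refine ⟨t, ht', ?_, hld⟩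
    rw [hl]
    refine ⟨h1, fun y hy => ?_⟩
    simpa [hld] using hx.2 y hy
  constructor
  · intro d
    constructor
    · intro hd v hv
      have : vectorSpan ℝ F ≤ LinearMap.ker (dotLeft v) := by
        rw [vectorSpan_def, Submodule.span_le]
        rintro _ ⟨a, ha, c, hc, rfl⟩
        simp [sub_dotProduct, hv.2 a ha, hv.2 c hc]
      exact this hd
    · intro hd
      obtain ⟨t, ht, htF, -⟩ := hmove d hd
      have h1 := vsub_mem_vectorSpan ℝ htF hx
      have h2 := (vectorSpan ℝ F).smul_mem t⁻¹ h1
      simpa [smul_smul, inv_mul_cancel₀ ht.ne'] using h2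
  -- With no tight vertex every direction is admissible, so `l` vanishes and exposes the whole dual.
  · intro hT
    have hl0 : ∀ d, l d = 0 := fun d => by
      obtain ⟨-, -, -, hd⟩ := hmove d (by simp [hT])
      exact hd
    rw [hl]
    ext y
    simp [hl0]

lemma zero_mem_dual : (0 : Fin n → ℝ) ∈ dualPolytope P := fun y _ => by simp

lemma affDim_dual (h : IsLatticePolytope P) : affDim (dualPolytope P) = n := by
  have hface : IsNonemptyFace (dualPolytope P) (dualPolytope P) :=
    ⟨⟨0, zero_mem_dual⟩, IsExposed.refl _⟩
  have htop : vectorSpan ℝ (dualPolytope P) = ⊤ := by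
    rw [eq_top_iff]
    intro d _
    rw [(face_structure h hface).1]
    intro v hv
    have := hv.2 0 zero_mem_dual
    simp at this
  rw [affDim, htop, finrank_top, Module.finrank_fin_fun]

lemma commonTight_nonempty_of_facet (h : IsLatticePolytope P) {F : Set (Fin n → ℝ)}
    (hF : IsFacet (dualPolytope P) F) : (commonTight P F).Nonempty := by
  rw [Set.nonempty_iff_ne_empty]
  intro hT
  have h1 := hF.2
  rw [(face_structure h hF.1).2 hT] at h1
  omega

/-- No tight vertex means codimension 0; a single one makes the direction space contain a
hyperplane, so the codimension is at most 1. -/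
lemma commonTight_nontrivial_of_ridge (h : IsLatticePolytope P) {F : Set (Fin n → ℝ)}
    (hF : IsRidge (dualPolytope P) F) : (commonTight P F).Nontrivial := by
  by_contra hT
  rw [Set.not_nontrivial_iff] at hT
  have h1 := hF.2
  rcases hT.eq_empty_or_singleton with hT | ⟨v, hT⟩
  · rw [(face_structure h hF.1).2 hT] at h1
    omega
  · rw [affDim_dual h] at h1
    have hv0 : v ≠ 0 := by
      rintro rfl
      obtain ⟨x, hx⟩ := hF.1.1
      have hv : (0 : Fin n → ℝ) ∈ commonTight P F := by rw [hT]; rfl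
      have := hv.2 x hx
      simp at this
    have hle : LinearMap.ker (dotLeft v) ≤ vectorSpan ℝ F := by
      intro d hd
      rw [(face_structure h hF.1).1, hT]
      rintro _ rfl
      exact hd
    have h2 := Submodule.finrank_mono hle
    have h3 := finrank_ker_dotLeft hv0
    unfold affDim at h1
    omega

lemma isFacet_of_commonTight (h : IsLatticePolytope P) {v x : Fin n → ℝ}
    (hv : v ∈ polytopeVertices P) (hx : x ∈ dualPolytope P) (hxv : x ⬝ᵥ v = -1)
    (huniq : ∀ w ∈ commonTight P {y ∈ dualPolytope P | y ⬝ᵥ v = -1}, w = v) :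
    IsFacet (dualPolytope P) {y ∈ dualPolytope P | y ⬝ᵥ v = -1} := by
  set F := {y ∈ dualPolytope P | y ⬝ᵥ v = -1} with hFdef
  have hface : IsNonemptyFace (dualPolytope P) F := by
    refine ⟨⟨x, hx, hxv⟩, fun _ => ⟨-(LinearMap.toContinuousLinearMap (dotLeft v)), ?_⟩⟩
    ext z
    constructor
    · rintro ⟨hz, hz1⟩
      refine ⟨hz, fun u hu => ?_⟩
      have := hu v hv.1
      simp [hz1]; linarith
    · rintro ⟨hz, hz1⟩
      refine ⟨hz, le_antisymm ?_ (hz v hv.1)⟩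
      have := hz1 x hx
      simp [hxv] at this
      linarith
  refine ⟨hface, ?_⟩
  have hv0 : v ≠ 0 := by
    rintro rfl
    simp at hxv
  have hspan : vectorSpan ℝ F = LinearMap.ker (dotLeft v) := by
    ext d
    rw [(face_structure h hface).1]
    constructor
    · intro hd
      exact hd v ⟨hv, fun y hy => hy.2⟩
    · intro hd w hw
      rw [huniq w hw]
      exact hd
  rw [affDim_dual h, affDim, hspan, finrank_ker_dotLeft hv0]

end polytope

/-! ### Unimodular smooth Fano polytopes -/

section USFP

variable {n : ℕ} {P : Set (Fin n → ℝ)}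

/-- The vertices tight at a point of the dual extend to a lattice basis consisting of the tight
vertices of another point of the dual. -/
lemma exists_facet_basis (hP : IsUSFP P) {x : Fin n → ℝ} (hx : x ∈ dualPolytope P)
    (hne : (tightVertices P x).Nonempty) :
    ∃ b : Module.Basis (Fin n) ℝ (Fin n → ℝ), (∀ i, b i ∈ polytopeVertices P) ∧
      (∀ x ∈ stdLattice n, ∀ i, ∃ z : ℤ, b.repr x i = z) ∧
      ∃ y ∈ dualPolytope P, tightVertices P x ⊆ tightVertices P y ∧
        Set.range b = tightVertices P y := by
  have hs := hP.1
  obtain ⟨G, hG, y, hy, hxy, hGy⟩ := exists_facet hs.latticePolytope hs.dim_eq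
    hs.zero_mem_interior hx hne
  have hfin : (polytopeVertices G).Finite := by
    rw [hGy]; exact (vertices_finite hs.latticePolytope).subset (Set.sep_subset _ _)
  obtain ⟨b, hb, hint⟩ := exists_basis_of_isLatticeBasis (hs.smooth G hG) (hs.simplicial G hG) hfin
  refine ⟨b, fun i => ?_, hint, y, hy, hxy, hb.trans hGy⟩
  have : b i ∈ polytopeVertices G := hb ▸ Set.mem_range_self i
  rw [hGy] at this
  exact this.1

lemma vertex_ne_zero (hP : IsUSFP P) {v : Fin n → ℝ} (hv : v ∈ polytopeVertices P) : v ≠ 0 := by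
  rintro rfl
  have := (hP.1.primitive 0 hv).2 0 0 (Submodule.zero_mem _) (by simp)
  simp at this

lemma convex_of_latticePolytope (h : IsLatticePolytope P) : Convex ℝ P := by
  obtain ⟨S, -, rfl⟩ := h
  exact convex_convexHull ℝ _

/-- The coordinate functional `b.repr · i` as a vector. -/
noncomputable def dualVector (b : Module.Basis (Fin n) ℝ (Fin n → ℝ)) (i : Fin n) : Fin n → ℝ :=
  fun j => b.repr (Pi.single j 1) i

lemma dualVector_dotProduct (b : Module.Basis (Fin n) ℝ (Fin n → ℝ)) (i : Fin n)
    (x : Fin n → ℝ) : dualVector b i ⬝ᵥ x = b.repr x i := by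
  have hx : x = ∑ j, x j • (Pi.single j 1 : Fin n → ℝ) := by
    ext k; simp [Finset.sum_apply, Pi.single_apply]
  conv_rhs => rw [hx]
  simp [dotProduct, dualVector, mul_comm]

lemma single_mem_stdLattice (j : Fin n) : (Pi.single j 1 : Fin n → ℝ) ∈ stdLattice n := by
  rw [mem_stdLattice_iff]
  intro i
  by_cases h : i = j
  · exact ⟨1, by simp [h]⟩
  · exact ⟨0, by simp [h]⟩

lemma dualVector_mem_stdLattice {b : Module.Basis (Fin n) ℝ (Fin n → ℝ)}
    (hint : ∀ x ∈ stdLattice n, ∀ i, ∃ z : ℤ, b.repr x i = z) (i : Fin n) :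
    dualVector b i ∈ stdLattice n := by
  rw [mem_stdLattice_iff]
  exact fun j => hint _ (single_mem_stdLattice j) i

/-- The change of coordinates to a basis of `ℤⁿ` is given by an integer matrix of
determinant `±1`. -/
lemma exists_int_matrix_repr (b : Module.Basis (Fin n) ℝ (Fin n → ℝ))
    (hb : ∀ i, b i ∈ stdLattice n)
    (hint : ∀ x ∈ stdLattice n, ∀ i, ∃ z : ℤ, b.repr x i = z) :
    ∃ W : Matrix (Fin n) (Fin n) ℤ, (W.det = 1 ∨ W.det = -1) ∧
      ∀ x, (W.map (fun z : ℤ => (z : ℝ))).mulVec x = fun i => b.repr x i := by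
  choose W hW using fun i j => hint _ (single_mem_stdLattice (n := n) j) i
  choose M hM using fun i => (mem_stdLattice_iff _).1 (hb i)
  have hmul : ∀ x, ((Matrix.of W).map (fun z : ℤ => (z : ℝ))).mulVec x = fun i => b.repr x i := by
    intro x
    ext i
    rw [← dualVector_dotProduct]
    simp only [Matrix.mulVec, dotProduct, dualVector, hW, Matrix.map_apply, Matrix.of_apply]
  refine ⟨Matrix.of W, ?_, hmul⟩
  -- The columns of the second factor are the basis vectors, so `W` has an integer inverse.
  have hone : Matrix.of W * Matrix.of (fun i j => M j i) = 1 := by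
    ext i j
    have h1 := congrFun (hmul (b j)) i
    have h2 : ((Matrix.of W * Matrix.of (fun i j => M j i)) i j : ℝ)
        = (1 : Matrix (Fin n) (Fin n) ℝ) i j := by
      rw [Module.Basis.repr_self, Finsupp.single_apply] at h1
      rw [Matrix.one_apply, Matrix.mul_apply]
      simp only [Matrix.mulVec, dotProduct, Matrix.map_apply, Matrix.of_apply] at h1 ⊢
      push_cast
      simp only [hM] at h1
      rw [h1]
      simp [eq_comm]
    have h3 : ((1 : Matrix (Fin n) (Fin n) ℝ) i j) = (((1 : Matrix (Fin n) (Fin n) ℤ) i j : ℤ) : ℝ) := by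
      simp [Matrix.one_apply]
    rw [h3] at h2
    exact_mod_cast h2
  have hdet := congrArg Matrix.det hone
  rw [Matrix.det_mul, Matrix.det_one] at hdet
  exact Int.eq_one_or_neg_one_of_mul_eq_one hdet

/-! ### The strong Ewald condition -/

theorem strongEwald (hP : IsUSFP P) : StrongEwald P := by
  classical
  intro v hv
  have hL := hP.1.latticePolytope
  have hlat := vertices_lattice hL
  obtain ⟨x, hx, hxv⟩ := exists_dual_tight (convex_of_latticePolytope hL)
    hP.1.zero_mem_interior hv (vertex_ne_zero hP hv)
  obtain ⟨b, hb, hint, y, hy, hxy, hby⟩ := exists_facet_basis hP hx ⟨v, hv, hxv⟩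
  obtain ⟨i₀, hi₀⟩ : v ∈ Set.range b := hby ▸ hxy ⟨hv, hxv⟩
  have hcoord : ∀ {u}, u ∈ polytopeVertices P → ∀ i, _ := fun {u} hu i =>
    repr_vertex_mem hP.2 b hb hlat hint hu i
  -- If some vertex has equal nonzero coordinates at i₀ and i, none has opposite nonzero ones, so
  -- the difference is bounded by 1; if there is no such vertex, the sum is.
  have hsign : ∀ i, i ≠ i₀ → ∃ e : ℤ, (e = 1 ∨ e = -1) ∧ ∀ u ∈ polytopeVertices P,
      -1 ≤ b.repr u i₀ + e * b.repr u i ∧ b.repr u i₀ + e * b.repr u i ≤ 1 := by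
    intro i hi
    by_cases hex : ∃ u ∈ polytopeVertices P, b.repr u i₀ = b.repr u i ∧ b.repr u i₀ ≠ 0
    · obtain ⟨u, hu, hu1, hu2⟩ := hex
      refine ⟨-1, Or.inr rfl, fun w hw => ?_⟩
      have hno := fun h2 h3 => no_two_by_two_minor_of_abs_two hP.2 b hb hlat hu hw hi.symm hu1 h2
        ((hcoord hu i₀).resolve_left hu2) h3
      rcases hcoord hw i₀ with h | h | h <;> rcases hcoord hw i with h' | h' | h' <;>
        (rw [h, h'] at hno ⊢; revert hno; norm_num)
    · push Not at hex
      refine ⟨1, Or.inl rfl, fun w hw => ?_⟩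
      have hno := hex w hw
      rcases hcoord hw i₀ with h | h | h <;> rcases hcoord hw i with h' | h' | h' <;>
        (rw [h, h'] at hno ⊢; revert hno; norm_num)
  have hsign' : ∀ i, ∃ e : ℤ, (e = 1 ∨ e = -1) ∧ (i = i₀ → e = 1) ∧ (i ≠ i₀ →
      ∀ u ∈ polytopeVertices P,
        -1 ≤ b.repr u i₀ + e * b.repr u i ∧ b.repr u i₀ + e * b.repr u i ≤ 1) := by
    intro i
    by_cases hi : i = i₀
    · exact ⟨1, Or.inl rfl, fun _ => rfl, fun h => absurd hi h⟩
    · obtain ⟨e, he, he'⟩ := hsign i hi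
      exact ⟨e, he, fun h => absurd h hi, fun _ => he'⟩
  choose e he he0 hebd using hsign'
  obtain ⟨W, hWdet, hW⟩ := exists_int_matrix_repr b (fun i => hlat _ (hb i)) hint
  let c : Fin n → ℤ := fun i => if i = i₀ then 0 else 1
  -- Row i₀ is added to every other row of the sign matrix, which preserves the determinant. The
  -- added 1 is also what sends v, the basis vector i₀, to the all-ones vector.
  let E : Matrix (Fin n) (Fin n) ℤ :=
    Matrix.of fun i j => Matrix.diagonal e i j + c i * Matrix.diagonal e i₀ j
  have hE : E.det = 1 ∨ E.det = -1 := by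
    have h1 : E.det = (Matrix.diagonal e).det :=
      Matrix.det_eq_of_forall_row_eq_smul_add_const c i₀ (by simp [c]) (fun i j => rfl)
    rw [h1, Matrix.det_diagonal, ← Int.isUnit_iff]
    exact (IsUnit.prod_univ_iff).2 fun i => Int.isUnit_iff.2 (he i)
  have hφ : ∀ u i, Matrix.toLin' ((E * W).map (fun z : ℤ => (z : ℝ))) u i =
      (e i : ℝ) * b.repr u i + c i * b.repr u i₀ := by
    intro u i
    have hmap : (E * W).map (fun z : ℤ => (z : ℝ)) =
        E.map (fun z : ℤ => (z : ℝ)) * W.map (fun z : ℤ => (z : ℝ)) :=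
      Matrix.map_mul (f := Int.castRingHom ℝ)
    rw [hmap, Matrix.toLin'_apply, ← Matrix.mulVec_mulVec, hW]
    simp [Matrix.mulVec, dotProduct, E, add_mul, Finset.sum_add_distrib, Matrix.diagonal_apply,
      he0 i₀ rfl]
  refine ⟨_, ⟨E * W, ?_, rfl⟩, ?_, ?_⟩
  · rw [Matrix.det_mul]
    rcases hE with h | h <;> rcases hWdet with h' | h' <;> simp [h, h']
  · have hvert : ∀ i, ∀ u ∈ polytopeVertices P,
        -1 ≤ (e i : ℝ) * b.repr u i + c i * b.repr u i₀ ∧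
          (e i : ℝ) * b.repr u i + c i * b.repr u i₀ ≤ 1 := by
      intro i u hu
      by_cases hi : i = i₀
      · subst hi
        rw [he0 i rfl]
        rcases hcoord hu i with h | h | h <;> simp [c, h]
      · have := hebd i hi u hu
        simp only [c, hi, if_false, Int.cast_one, one_mul]
        constructor <;> linarith
    intro u hu i
    rw [hφ]
    have hdot : ∀ w, ((e i : ℝ) • dualVector b i + (c i : ℝ) • dualVector b i₀) ⬝ᵥ w =
        (e i : ℝ) * b.repr w i + c i * b.repr w i₀ := by
      intro w
      simp [add_dotProduct, smul_dotProduct, dualVector_dotProduct]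
    constructor
    · rw [← hdot]
      refine forall_le_of_vertices hL (fun w hw => ?_) u hu
      rw [hdot]; exact (hvert i w hw).1
    · have := forall_le_of_vertices hL (c := -1)
        (x := -((e i : ℝ) • dualVector b i + (c i : ℝ) • dualVector b i₀)) (fun w hw => ?_) u hu
      · rw [neg_dotProduct, hdot] at this
        linarith
      · rw [neg_dotProduct, hdot]; linarith [(hvert i w hw).2]
  · ext i
    rw [hφ, ← hi₀, Module.Basis.repr_self]
    by_cases hi : i = i₀
    · subst hi; simp [c, he0 i rfl]
    · simp [c, hi]

/-! ### The star Ewald condition for the dual -/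

theorem starEwald (hP : IsUSFP P) : StarEwald (dualPolytope P) := by
  classical
  intro f hf hfne
  have hL := hP.1.latticePolytope
  have hlat := vertices_lattice hL
  obtain ⟨v, hv⟩ : (commonTight P f).Nonempty := by
    rw [Set.nonempty_iff_ne_empty]
    exact fun h => hfne ((face_structure hL hf).2 h)
  obtain ⟨x, hx⟩ := hf.1
  have hfQ : f ⊆ dualPolytope P := hf.2.subset
  -- Every vertex tight on all of f is tight at x, hence belongs to this basis.
  obtain ⟨b, hb, hint, y, hy, hxy, hby⟩ := exists_facet_basis hP (hfQ hx) ⟨v, hv.1, hv.2 x hx⟩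
  have hcommon : ∀ w ∈ commonTight P f, ∃ i, b i = w := by
    intro w hw
    have : w ∈ Set.range b := hby ▸ hxy ⟨hw.1, hw.2 x hx⟩
    exact this
  obtain ⟨i₀, rfl⟩ := hcommon v hv
  have hcoord : ∀ {u}, u ∈ polytopeVertices P → ∀ i, _ := fun {u} hu i =>
    repr_vertex_mem hP.2 b hb hlat hint hu i
  have hdot : ∀ u, (-dualVector b i₀) ⬝ᵥ u = -b.repr u i₀ := fun u => by
    rw [neg_dotProduct, dualVector_dotProduct]
  have hmem : -dualVector b i₀ ∈ dualPolytope P := by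
    rw [mem_dual_iff hL]
    intro u hu
    rw [hdot]
    rcases hcoord hu i₀ with h | h | h <;> rw [h] <;> norm_num
  have hmem' : dualVector b i₀ ∈ dualPolytope P := by
    rw [mem_dual_iff hL]
    intro u hu
    rw [dualVector_dotProduct]
    rcases hcoord hu i₀ with h | h | h <;> rw [h] <;> norm_num
  have hself : (-dualVector b i₀) ⬝ᵥ b i₀ = -1 := by rw [hdot]; simp
  -- λ takes the value -1 at `b i₀` and 0 at the other basis vectors, so it is tight at just one
  -- vertex common to f.
  have huniq : ∀ w ∈ commonTight P f, (-dualVector b i₀) ⬝ᵥ w = -1 → w = b i₀ := by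
    intro w hw h
    obtain ⟨i, rfl⟩ := hcommon w hw
    rw [hdot, Module.Basis.repr_self, Finsupp.single_apply] at h
    by_contra hne
    rw [if_neg (fun hi => hne (by rw [hi]))] at h
    norm_num at h
  refine ⟨-dualVector b i₀, ⟨⟨hmem, by simpa using hmem'⟩,
    Submodule.neg_mem _ (dualVector_mem_stdLattice hint i₀)⟩, ⟨?_, ?_⟩, ?_⟩
  · refine ⟨{z ∈ dualPolytope P | z ⬝ᵥ b i₀ = -1}, ⟨?_, fun z hz => ⟨hfQ hz, hv.2 z hz⟩⟩,
      hmem, hself⟩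
    refine isFacet_of_commonTight hL hv.1 hmem hself fun w hw => ?_
    exact huniq w ⟨hw.1, fun z hz => hw.2 z ⟨hfQ hz, hv.2 z hz⟩⟩ (hw.2 _ ⟨hmem, hself⟩)
  -- A ridge through f and λ would have two distinct vertices tight at λ and on f.
  · rintro ⟨R, ⟨hR, hfR⟩, hRm⟩
    obtain ⟨u, hu, w, hw, huw⟩ := commonTight_nontrivial_of_ridge hL hR
    have hmono : ∀ w ∈ commonTight P R, w = b i₀ := fun w hw =>
      huniq w ⟨hw.1, fun z hz => hw.2 z (hfR hz)⟩ (hw.2 _ hRm)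
    exact huw ((hmono u hu).trans (hmono w hw).symm)
  -- A facet through f and -λ would have a basis vector tight at -λ, whose values on the basis are
  -- only 0 and 1.
  · rintro ⟨F, ⟨hF, hfF⟩, hFm⟩
    obtain ⟨w, hw⟩ := commonTight_nonempty_of_facet hL hF
    obtain ⟨i, rfl⟩ := hcommon w ⟨hw.1, fun z hz => hw.2 z (hfF hz)⟩
    have h := hw.2 _ hFm
    rw [neg_neg, dualVector_dotProduct, Module.Basis.repr_self, Finsupp.single_apply] at h
    split_ifs at h <;> norm_num at h

end USFP

end USFP

theorem theorem1 (n : ℕ) (P : Set (Fin n → ℝ)) (hP : IsUSFP P) :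
    StrongEwald P ∧ StarEwald (dualPolytope P) :=
  ⟨USFP.strongEwald hP, USFP.starEwald hP⟩
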